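/- Let $\mathsf k$ be a field, $S$ a polynomial ring over $\mathsf k$, and let $\Delta$ be a simplicial complex on a finite, linearly ordered vertex set. A facet $F$ of a simplicial complex $\Gamma$ is a leaf if $F$ is the only facet of $\Gamma$, or there is a facet $G\neq F$ of $\Gamma$ such that $F\cap H\subseteq G$ for every facet $H\neq F$ of $\Gamma$. Suppose that $\Delta$ is a quasi-tree: it is connected (in particular it has a vertex), and its facets can be ordered, without repetition, as $F_1,\dots,F_q$ so that, for every $i$, $F_i$ is a leaf of the simplicial complex $\langle F_1,\dots,F_i\rangle$ whose faces are the subsets of $F_1,\dots,F_i$. Label each vertex $v$ of $\Delta$ with a monomial $m_v$ of $S$, let $I$ be the ideal of $S$ generated by all the $m_v$, and for every face $\sigma$ of $\Delta$ put $M_\sigma=\operatorname{lcm}(m_v : v\in\sigma)$. For $t\ge 0$ let $(\mathbb F_\Delta)_t$ be the free $S$-module with basis elements $e_\sigma$, of multidegree $M_\sigma$, indexed by the faces $\sigma$ of $\Delta$ with $|\sigma|=t+1$. For a face $\sigma=\{v_0<\dots<v_t\}$ with $t\ge 1$ put $$\partial(e_\sigma)=\sum_{j=0}^{t}(-1)^j\,\frac{M_\sigma}{M_{\sigma\setminus\{v_j\}}}\,e_{\sigma\setminus\{v_j\}},$$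 and let $(\mathbb F_\Delta)_0\to I$ be the $S$-linear map sending $e_{\{v\}}$ to $m_v$. The complex $\Delta$ is said to support a free resolution of $I$ if the sequence $$\cdots\to(\mathbb F_\Delta)_2\to(\mathbb F_\Delta)_1\to(\mathbb F_\Delta)_0\to I\to 0$$ is exact. For a monomial $M$ of $S$ let $\Delta_M$ be the induced subcomplex of $\Delta$ on the vertices whose labels divide $M$. Then $\Delta$ supports a free resolution of $I$ over $S$ if and only if, for every monomial $M$ of $S$, the complex $\Delta_M$ is empty (has no vertices) or connected. -/

import Mathlib

namespace QuasiTree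

/-! Simplicial complexes are Mathlib's `PreAbstractSimplicialComplex V`: downward closed families of
nonempty finite subsets of `V` (the empty face is left out, and an element `v : V` is a vertex
only when `{v}` is a face). -/

section Combinatorics

variable {V : Type*}

/-- The vertices of `Δ`. -/
def vertices (Δ : PreAbstractSimplicialComplex V) : Set V := {v | {v} ∈ Δ}

/-- A facet is a face that is maximal under inclusion. -/
def IsFacet (Δ : PreAbstractSimplicialComplex V) (F : Finset V) : Prop := Maximal (· ∈ Δ) F

/-- The simplicial complex `⟨A⟩` generated by a family `A` of finite sets: its faces are the
nonempty subsets of the members of `A`. -/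
def generatedBy (A : Set (Finset V)) : PreAbstractSimplicialComplex V where
  faces := {s | s.Nonempty ∧ ∃ F ∈ A, s ⊆ F}
  isRelLowerSet_faces := by
    rintro s ⟨hs, F, hF, hsF⟩
    exact ⟨hs, fun t hts ht => ⟨ht, F, hF, Finset.Subset.trans hts hsF⟩⟩

/-- The induced subcomplex of `Δ` on `W`: the faces of `Δ` contained in `W`. -/
def induced (Δ : PreAbstractSimplicialComplex V) (W : Set V) : PreAbstractSimplicialComplex V where
  faces := {s | s ∈ Δ ∧ (s : Set V) ⊆ W}
  isRelLowerSet_faces := by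
    rintro s ⟨hs, hsW⟩
    have h := Δ.isRelLowerSet_faces hs
    exact ⟨h.1, fun t hts ht => ⟨h.2 hts ht, fun x hx => hsW (hts hx)⟩⟩

variable [DecidableEq V]

/-- A leaf is a facet `F` which is the only facet, or which has a joint: a facet `G ≠ F` such that
`F ∩ H ⊆ G` for all facets `H ≠ F`. -/
def IsLeaf (Δ : PreAbstractSimplicialComplex V) (F : Finset V) : Prop :=
  IsFacet Δ F ∧
    ((∀ H, IsFacet Δ H → H = F) ∨
      ∃ G, IsFacet Δ G ∧ G ≠ F ∧ ∀ H, IsFacet Δ H → H ≠ F → F ∩ H ⊆ G)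

/-- A quasi-forest: the facets can be listed, without repetition, as `F 0, …, F (q - 1)` so that
each `F i` is a leaf of the complex generated by `F 0, …, F i`. -/
def IsQuasiForest (Δ : PreAbstractSimplicialComplex V) : Prop :=
  ∃ (q : ℕ) (F : Fin q → Finset V), Function.Injective F ∧ Set.range F = {G | IsFacet Δ G} ∧
    ∀ i : Fin q, IsLeaf (generatedBy (F '' Set.Iic i)) (F i)

/-- The graph of vertices and edges (one-dimensional faces) of `Δ`. -/
def edgeGraph (Δ : PreAbstractSimplicialComplex V) : SimpleGraph (vertices Δ) where
  Adj u v := u ≠ v ∧ {(u : V), (v : V)} ∈ Δ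
  symm := ⟨fun u v h => ⟨h.1.symm, by rw [Finset.pair_comm]; exact h.2⟩⟩
  loopless := ⟨fun _ h => h.1 rfl⟩

/-- A simplicial complex is connected if it has a vertex and any two of its vertices are joined by
a path of edges. -/
def IsConnected (Δ : PreAbstractSimplicialComplex V) : Prop := (edgeGraph Δ).Connected

/-- A quasi-tree is a connected quasi-forest. -/
def IsQuasiTree (Δ : PreAbstractSimplicialComplex V) : Prop := IsConnected Δ ∧ IsQuasiForest Δ

end Combinatorics

noncomputable section Resolution

open MvPolynomial

/-! Monomials of the polynomial ring `MvPolynomial σ k` are represented by their exponent vectors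
`σ →₀ ℕ`, so that divisibility of monomials is `≤` and least common multiple is `⊔`. A labeling of
the vertices by monomials is a function `m : V → σ →₀ ℕ`. -/

variable {V σ : Type*} [LinearOrder V]

/-- The faces of `Δ` with `t + 1` vertices. -/
abbrev FaceOfDim (Δ : PreAbstractSimplicialComplex V) (t : ℕ) : Type _ :=
  {s : Finset V // s ∈ Δ ∧ s.card = t + 1}

/-- The label `M_s` of a face: the least common multiple of the labels of its vertices. -/
def faceLabel (m : V → σ →₀ ℕ) (s : Finset V) : σ →₀ ℕ := s.sup m

/-- The face `s ∖ {v}`. -/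
def eraseFace (Δ : PreAbstractSimplicialComplex V) {t : ℕ} (s : FaceOfDim Δ (t + 1))
    (v : {v // v ∈ s.1}) : FaceOfDim Δ t :=
  ⟨s.1.erase v.1, by
    have hc : (s.1.erase v.1).card = t + 1 := by
      rw [Finset.card_erase_of_mem v.2, s.2.2, Nat.add_sub_cancel]
    exact ⟨(Δ.isRelLowerSet_faces s.2.1).2 (Finset.erase_subset _ _)
      (Finset.card_pos.mp (by omega)), hc⟩⟩

/-- The free module in homological degree `t` of the homogenized chain complex of `Δ`, with one
basis element `e_s` (of multidegree `M_s`) for each face `s` with `t + 1` vertices. -/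
abbrev ChainModule (k : Type*) [Field k] (σ : Type*) (Δ : PreAbstractSimplicialComplex V) (t : ℕ) :
    Type _ :=
  FaceOfDim Δ t →₀ MvPolynomial σ k

/-- The differential `e_s ↦ ∑ (-1) ^ j (M_s / M_{s ∖ v}) e_{s ∖ v}`, the sum running over the
vertices `v` of `s`, where `j` is the number of vertices of `s` that precede `v`. The label of
`s ∖ v` divides that of `s`, so the difference of exponent vectors is that of the quotient, and the
differential preserves the multidegrees. -/
def boundary (k : Type*) [Field k] (Δ : PreAbstractSimplicialComplex V) (m : V → σ →₀ ℕ) (t : ℕ) :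
    ChainModule k σ Δ (t + 1) →ₗ[MvPolynomial σ k] ChainModule k σ Δ t :=
  Finsupp.linearCombination (MvPolynomial σ k) fun s =>
    ∑ v ∈ s.1.attach, Finsupp.single (eraseFace Δ s v)
      ((-1) ^ (s.1.filter (· < v.1)).card *
        monomial (faceLabel m s.1 - faceLabel m (s.1.erase v.1)) (1 : k))

/-- The augmentation from homological degree `0` to the polynomial ring: the basis element of a
vertex is sent to the label of this vertex. -/
def augmentation (k : Type*) [Field k] (Δ : PreAbstractSimplicialComplex V) (m : V → σ →₀ ℕ) :
    ChainModule k σ Δ 0 →ₗ[MvPolynomial σ k] MvPolynomial σ k :=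
  Finsupp.linearCombination (MvPolynomial σ k) fun s => monomial (faceLabel m s.1) (1 : k)

/-- `Δ`, with vertex labels `m`, supports a free resolution of `I`: the sequence
`⋯ → F₂ → F₁ → F₀ → I → 0` given by the homogenized chain complex of `Δ` is exact. -/
def SupportsFreeResolution {k : Type*} [Field k] (Δ : PreAbstractSimplicialComplex V)
    (m : V → σ →₀ ℕ) (I : Ideal (MvPolynomial σ k)) : Prop :=
  LinearMap.range (augmentation k Δ m) = I ∧
    Function.Exact (boundary k Δ m 0) (augmentation k Δ m) ∧
      ∀ t, Function.Exact (boundary k Δ m (t + 1)) (boundary k Δ m t)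

/-- `Δ_M`: the induced subcomplex of `Δ` on the vertices whose labels divide the monomial `M`. -/
def restrictTo (Δ : PreAbstractSimplicialComplex V) (m : V → σ →₀ ℕ) (M : σ →₀ ℕ) :
    PreAbstractSimplicialComplex V :=
  induced Δ {v | m v ≤ M}

end Resolution

end QuasiTree

namespace QuasiTree

/-! ### Free vertices and connectedness of induced subcomplexes -/

section Combinatorics

variable {V : Type*}

/-! The sequence splits by multidegree: its strand at `M` is the augmented chain complex of `Δ_M`
over `k` (`component_boundary`, `coeff_augmentation`). Resolving `I` thus means that each nonempty
`Δ_M` is acyclic over `k`, and the claim is that for a quasi-forest connectedness already suffices.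

The leaf order gives every induced subcomplex with a vertex a free vertex `v`
(`IsQuasiForest.hasFreeVertices`). If `w` is a neighbour of `v`, the faces through `v` can be coned
off from `w`, which pushes any cycle off `v` up to a boundary. Deleting `v` keeps the subcomplex
connected, so induction on the vertex set shows that it is acyclic
(`HasFreeVertices.exists_scalarBoundary_eq`).

Conversely, exactness at degree 0 makes the difference of two vertices of `Δ_M` a boundary, so they
lie in one component (`linked_of_exact`). -/

theorem mem_of_subset {Δ : PreAbstractSimplicialComplex V} {s t : Finset V} (hs : s ∈ Δ)
    (hts : t ⊆ s) (ht : t.Nonempty) : t ∈ Δ :=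
  (Δ.isRelLowerSet_faces hs).2 hts ht

theorem nonempty_of_mem {Δ : PreAbstractSimplicialComplex V} {s : Finset V} (hs : s ∈ Δ) :
    s.Nonempty :=
  (Δ.isRelLowerSet_faces hs).1

theorem singleton_mem_of_mem {Δ : PreAbstractSimplicialComplex V} {s : Finset V} (hs : s ∈ Δ)
    {v : V} (hv : v ∈ s) : {v} ∈ Δ :=
  mem_of_subset hs (Finset.singleton_subset_iff.2 hv) (Finset.singleton_nonempty v)

theorem exists_isFacet_superset [Finite V] {Δ : PreAbstractSimplicialComplex V} {s : Finset V}
    (hs : s ∈ Δ) : ∃ F, IsFacet Δ F ∧ s ⊆ F := by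
  have hfin : {t : Finset V | t ∈ Δ}.Finite := Set.toFinite _
  obtain ⟨F, hsF, hF⟩ := hfin.exists_le_maximal hs
  exact ⟨F, hF, hsF⟩

/-- Every induced subcomplex with a vertex has a free vertex: the union of two faces containing
this vertex is again a face. -/
def HasFreeVertices [DecidableEq V] (Δ : PreAbstractSimplicialComplex V) : Prop :=
  ∀ W : Set V, (∃ v ∈ W, {v} ∈ Δ) → ∃ v ∈ W, {v} ∈ Δ ∧
    ∀ s ∈ Δ, ∀ t ∈ Δ, (s : Set V) ⊆ W → (t : Set V) ⊆ W → v ∈ s → v ∈ t → s ∪ t ∈ Δ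

/-- Take the shortest initial segment of the leaf order whose facets contain all faces inside `W`.
Its last facet has a vertex in `W` lying in no earlier one, since otherwise the joint would make
that facet superfluous. Every face inside `W` through this vertex lies in the last facet. -/
theorem IsQuasiForest.hasFreeVertices [Finite V] [DecidableEq V]
    {Δ : PreAbstractSimplicialComplex V} (h : IsQuasiForest Δ) : HasFreeVertices Δ := by
  classical
  obtain ⟨q, F, hinj, hrange, hleaf⟩ := h
  have hFacet : ∀ i, IsFacet Δ (F i) := fun i => by
    have : F i ∈ Set.range F := ⟨i, rfl⟩
    rwa [hrange] at this
  rintro W ⟨a, haW, ha⟩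
  have hex : ∃ n : ℕ, ∀ s ∈ Δ, (s : Set V) ⊆ W → ∃ j : Fin q, j.val < n ∧ s ⊆ F j := by
    refine ⟨q, fun s hs _ => ?_⟩
    obtain ⟨G, hG, hsG⟩ := exists_isFacet_superset hs
    have : G ∈ Set.range F := by rw [hrange]; exact hG
    obtain ⟨j, rfl⟩ := this
    exact ⟨j, j.2, hsG⟩
  have hspec := Nat.find_spec hex
  have hmin : ∀ n < Nat.find hex, _ := fun n hn => Nat.find_min hex hn
  generalize Nat.find hex = n at hspec hmin
  obtain ⟨j, hj, -⟩ := hspec {a} ha (by simpa using haW)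
  obtain ⟨i, rfl⟩ : ∃ i, n = i + 1 := ⟨n - 1, by omega⟩
  have hi := hmin i (by omega)
  push Not at hi
  obtain ⟨s, hs, hsW, hsF⟩ := hi
  obtain ⟨l, hl, hsl⟩ := hspec s hs hsW
  have hli : l.val = i := by
    by_contra hne
    exact hsF l (by omega) hsl
  subst hli
  have hfree : ∃ v ∈ s, ∀ j : Fin q, j < l → v ∉ F j := by
    by_contra! hcon
    -- Facets of `Δ` stay facets of the partial complex, so the leaf condition applies to them.
    have hsub : ∀ j ≤ l, IsFacet (generatedBy (F '' Set.Iic l)) (F j) := fun j hjl => by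
      refine ⟨⟨nonempty_of_mem (hFacet j).1, F j, ⟨j, hjl, rfl⟩, subset_rfl⟩, ?_⟩
      rintro t ⟨ht, G, ⟨j', -, rfl⟩, htG⟩ hjt
      exact (hFacet j).2 (mem_of_subset (hFacet j').1 htG ht) hjt
    rcases (hleaf l).2 with honly | ⟨G, hG, hGl, hjoint⟩
    · obtain ⟨v, hv⟩ := nonempty_of_mem hs
      obtain ⟨j, hjl, -⟩ := hcon v hv
      exact hjl.ne (hinj (honly _ (hsub j hjl.le)))
    · obtain ⟨-, G', ⟨j, hjl, rfl⟩, hGj⟩ := hG.1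
      have hGeq : F j ⊆ G := hG.2 (hsub j hjl).1 hGj
      have hne : j ≠ l := by
        rintro rfl
        exact hGl (hGj.antisymm hGeq)
      refine hsF j (Fin.lt_def.1 <| lt_of_le_of_ne (Set.mem_Iic.1 hjl) hne) fun v hv => hGj ?_
      obtain ⟨j', hj', hvj'⟩ := hcon v hv
      exact hjoint _ (hsub j' hj'.le) (fun h => hj'.ne (hinj h))
        (Finset.mem_inter.2 ⟨hsl hv, hvj'⟩)
  obtain ⟨v, hvs, hv⟩ := hfree
  have key : ∀ t ∈ Δ, (t : Set V) ⊆ W → v ∈ t → t ⊆ F l := fun t ht htW hvt => by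
    obtain ⟨j, hj, htj⟩ := hspec t ht htW
    rcases lt_or_eq_of_le (Nat.lt_succ_iff.1 hj) with h | h
    · exact absurd (htj hvt) (hv j h)
    · rwa [Fin.ext h] at htj
  refine ⟨v, hsW hvs, singleton_mem_of_mem hs hvs, fun s hs t ht hsW htW hvs hvt => ?_⟩
  exact mem_of_subset (hFacet l).1 (Finset.union_subset (key s hs hsW hvs) (key t ht htW hvt))
    ⟨v, Finset.mem_union_left _ hvs⟩

/-- The induced subcomplex on `W` is connected or empty: every property of vertices that propagates
along its edges propagates between all its vertices. -/
def Linked [DecidableEq V] (Δ : PreAbstractSimplicialComplex V) (W : Set V) : Prop :=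
  ∀ P : V → Prop, (∀ x ∈ W, ∀ y ∈ W, {x, y} ∈ Δ → P x → P y) →
    ∀ a ∈ W, ∀ b ∈ W, {a} ∈ Δ → {b} ∈ Δ → P a → P b

theorem mem_induced {Δ : PreAbstractSimplicialComplex V} {W : Set V} {s : Finset V} :
    s ∈ induced Δ W ↔ s ∈ Δ ∧ (s : Set V) ⊆ W := Iff.rfl

theorem singleton_mem_induced {Δ : PreAbstractSimplicialComplex V} {W : Set V} {v : V} :
    {v} ∈ induced Δ W ↔ {v} ∈ Δ ∧ v ∈ W := by
  rw [mem_induced, Finset.coe_singleton, Set.singleton_subset_iff]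

theorem linked_iff_induced_eq_bot_or_isConnected [DecidableEq V]
    {Δ : PreAbstractSimplicialComplex V} {W : Set V} :
    Linked Δ W ↔ induced Δ W = ⊥ ∨ IsConnected (induced Δ W) := by
  constructor
  · intro h
    by_cases hne : ∃ v, {v} ∈ induced Δ W
    · right
      obtain ⟨v, hv⟩ := hne
      have : Nonempty (vertices (induced Δ W)) := ⟨⟨v, hv⟩⟩
      refine ⟨fun a b => ?_⟩
      have ha := singleton_mem_induced.1 a.2
      have hb := singleton_mem_induced.1 b.2
      -- The propagated property is reachability from `a`; the existential extends it to all of `V`.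
      obtain ⟨_, hr⟩ : ∃ hx : {(b : V)} ∈ induced Δ W,
          (edgeGraph (induced Δ W)).Reachable a ⟨b, hx⟩ := h
        (fun x => ∃ hx : {x} ∈ induced Δ W, (edgeGraph (induced Δ W)).Reachable a ⟨x, hx⟩)
        (by
          rintro x hxW y hyW hxy ⟨hx, hr⟩
          have hy : {y} ∈ induced Δ W :=
            singleton_mem_induced.2 ⟨singleton_mem_of_mem hxy (by simp), hyW⟩
          refine ⟨hy, ?_⟩
          by_cases hne : x = y
          · subst hne
            exact hr
          · refine hr.trans (SimpleGraph.Adj.reachable ⟨fun h => hne (congrArg Subtype.val h), hxy, ?_⟩)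
            simp [Set.insert_subset_iff, hxW, hyW])
        a ha.2 b hb.2 ha.1 hb.1 ⟨a.2, SimpleGraph.Reachable.refl _⟩
      exact hr
    · left
      rw [eq_bot_iff]
      intro s hs
      obtain ⟨v, hv⟩ := nonempty_of_mem hs
      exact absurd ⟨v, singleton_mem_of_mem hs hv⟩ hne
  · rintro (h | h) P hP a haW b hbW ha hb hPa
    · have : {a} ∈ induced Δ W := singleton_mem_induced.2 ⟨ha, haW⟩
      rw [h] at this
      exact this.elim
    · obtain ⟨p⟩ := h.preconnected ⟨a, singleton_mem_induced.2 ⟨ha, haW⟩⟩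
        ⟨b, singleton_mem_induced.2 ⟨hb, hbW⟩⟩
      have key : ∀ x y : vertices (induced Δ W), (edgeGraph (induced Δ W)).Walk x y →
          P x → P y := by
        intro x y p
        induction p with
        | nil => exact id
        | @cons u v w huv p ih =>
          exact fun hu => ih (hP u (singleton_mem_induced.1 u.2).2 v
            (singleton_mem_induced.1 v.2).2 huv.2.1 hu)
      exact key _ _ p hPa

/-- Removing a vertex `v` such that the union of the edge `{v, w}` with any edge at `v` is a face
does not disconnect an induced subcomplex. -/
theorem Linked.diff_singleton [DecidableEq V] {Δ : PreAbstractSimplicialComplex V} {W : Set V}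
    (h : Linked Δ W) {v w : V} (hw : w ∈ W) (hwv : w ≠ v)
    (hv : ∀ x ∈ W, {v, x} ∈ Δ → {v, x} ∪ {v, w} ∈ Δ) : Linked Δ (W \ {v}) := by
  intro P hP a ha b hb haΔ hbΔ hPa
  have hwW : w ∈ W \ {v} := ⟨hw, hwv⟩
  -- `v` inherits the value of `P` at `w`: any neighbour of `v` other than `w` is also a neighbour
  -- of `w`, so paths through `v` can be rerouted.
  have := h (fun x => if x = v then P w else P x) (by
    intro x hx y hy hxy hPx
    by_cases hxv : x = v <;> by_cases hyv : y = v
    · simpa [hxv, hyv] using hPx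
    · subst hxv
      simp only [if_true, hyv, if_false] at hPx ⊢
      exact hP w hwW y ⟨hy, hyv⟩ (mem_of_subset (hv y hy hxy)
        (by intro z; simp only [Finset.mem_insert, Finset.mem_singleton, Finset.mem_union]; tauto)
        (by simp)) hPx
    · subst hyv
      simp only [if_true, hxv, if_false] at hPx ⊢
      exact hP x ⟨hx, hxv⟩ w hwW (mem_of_subset (hv x hx (Finset.pair_comm x y ▸ hxy))
        (by intro z; simp only [Finset.mem_insert, Finset.mem_singleton, Finset.mem_union]; tauto)
        (by simp)) hPx
    · simp only [hxv, hyv, if_false] at hPx ⊢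
      exact hP x ⟨hx, hxv⟩ y ⟨hy, hyv⟩ hxy hPx) a ha.1 b hb.1 haΔ hbΔ
      (by rw [if_neg (show a ≠ v from ha.2)]; exact hPa)
  rwa [if_neg (show b ≠ v from hb.2)] at this

end Combinatorics

/-! ### Scalar chains, cones and acyclicity -/

section Support

variable {V k : Type*} [Field k] {Δ : PreAbstractSimplicialComplex V} {W : Set V}

/-- The scalar chain `c` is supported on the empty face and the faces of `Δ` inside `W`. -/
def ChainIn (Δ : PreAbstractSimplicialComplex V) (W : Set V) (c : Finset V → k) : Prop :=
  ∀ s, c s ≠ 0 → s = ∅ ∨ s ∈ Δ ∧ (s : Set V) ⊆ W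

theorem ChainIn.add {c d : Finset V → k} (hc : ChainIn Δ W c) (hd : ChainIn Δ W d) :
    ChainIn Δ W (c + d) := by
  intro s hs
  by_cases h : c s = 0
  · exact hd s fun h' => hs (by simp [h, h'])
  · exact hc s h

theorem ChainIn.sub {c d : Finset V → k} (hc : ChainIn Δ W c) (hd : ChainIn Δ W d) :
    ChainIn Δ W (c - d) := by
  intro s hs
  by_cases h : c s = 0
  · exact hd s fun h' => hs (by simp [h, h'])
  · exact hc s h

theorem ChainIn.mono {W' : Set V} (h : W ⊆ W') {c : Finset V → k} (hc : ChainIn Δ W c) :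
    ChainIn Δ W' c := fun s hs => (hc s hs).imp_right fun h' => ⟨h'.1, h'.2.trans h⟩

end Support

section Chains

variable {V k : Type*} [LinearOrder V] [Field k]

/-- The diagonal needs its own hypothesis because of characteristic 2. -/
theorem sum_sum_eq_zero_of_antisymm {s : Finset V} {f : V → V → k}
    (hdiag : ∀ a, f a a = 0) (hf : ∀ a ∈ s, ∀ b ∈ s, f a b = -f b a) :
    ∑ a ∈ s, ∑ b ∈ s, f a b = 0 := by
  have hsplit : ∀ a ∈ s, ∀ b ∈ s,
      f a b = (if a < b then f a b else 0) - (if b < a then f b a else 0) := by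
    intro a ha b hb
    rcases lt_trichotomy a b with h | rfl | h
    · simp [h, h.asymm]
    · simp [hdiag]
    · simp [h, h.asymm, hf a ha b hb]
  rw [Finset.sum_congr rfl fun a ha => Finset.sum_congr rfl (hsplit a ha)]
  simp only [Finset.sum_sub_distrib]
  rw [sub_eq_zero, Finset.sum_comm]

/-- The sign with which `s` occurs in the boundary of `insert v s`. -/
def faceSign (k : Type*) [Field k] (v : V) (s : Finset V) : k := (-1) ^ (s.filter (· < v)).card

theorem faceSign_mul_self (v : V) (s : Finset V) : faceSign k v s * faceSign k v s = 1 := by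
  rw [faceSign, ← mul_pow]
  simp

theorem faceSign_insert {v w : V} {s : Finset V} (hw : w ∉ s) :
    faceSign k v (insert w s) = (if w < v then -1 else 1) * faceSign k v s := by
  unfold faceSign
  rw [Finset.filter_insert]
  split_ifs with h
  · rw [Finset.card_insert_of_notMem (by simp [hw]), pow_succ, mul_comm]
  · rw [one_mul]

theorem faceSign_mul_faceSign_insert {v w : V} {s : Finset V} (hv : v ∉ s) (hw : w ∉ s)
    (hvw : v ≠ w) :
    faceSign k v s * faceSign k w (insert v s) = -(faceSign k w s * faceSign k v (insert w s)) := by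
  rw [faceSign_insert hv, faceSign_insert hw]
  rcases hvw.lt_or_gt with h | h
  · simp [h, h.asymm, mul_comm]
  · simp [h, h.asymm, mul_comm]

variable [Fintype V]

/-- The boundary of a scalar chain on the full simplex on `V`, empty face included. -/
def scalarBoundary (c : Finset V → k) (s : Finset V) : k :=
  ∑ v ∈ sᶜ, faceSign k v s * c (insert v s)

theorem scalarBoundary_add (c d : Finset V → k) :
    scalarBoundary (c + d) = scalarBoundary c + scalarBoundary d := by
  funext s
  simp [scalarBoundary, mul_add, Finset.sum_add_distrib]

theorem scalarBoundary_sub (c d : Finset V → k) :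
    scalarBoundary (c - d) = scalarBoundary c - scalarBoundary d := by
  funext s
  simp [scalarBoundary, mul_sub, Finset.sum_sub_distrib]

theorem scalarBoundary_zero : scalarBoundary (0 : Finset V → k) = 0 := by
  funext s
  simp [scalarBoundary]

theorem scalarBoundary_scalarBoundary (c : Finset V → k) :
    scalarBoundary (scalarBoundary c) = 0 := by
  funext s
  have : scalarBoundary (scalarBoundary c) s = ∑ v ∈ sᶜ, ∑ w ∈ sᶜ, if v = w then 0 else
      faceSign k v s * (faceSign k w (insert v s) * c (insert w (insert v s))) := by
    refine Finset.sum_congr rfl fun v hv => ?_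
    rw [scalarBoundary, Finset.mul_sum, Finset.compl_insert, ← Finset.sum_erase_add _ _ hv]
    simp only [if_true, add_zero]
    exact Finset.sum_congr rfl fun w hw => by rw [if_neg (Finset.ne_of_mem_erase hw).symm]
  rw [this]
  refine sum_sum_eq_zero_of_antisymm (fun a => if_pos rfl) fun a ha b hb => ?_
  rw [Finset.mem_compl] at ha hb
  by_cases hab : a = b
  · simp [hab]
  · rw [if_neg hab, if_neg (Ne.symm hab), ← mul_assoc, ← mul_assoc,
      faceSign_mul_faceSign_insert ha hb hab, Finset.insert_comm, neg_mul]

/-- The cone with apex `w` over a scalar chain. -/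
def cone (w : V) (c : Finset V → k) (s : Finset V) : k :=
  if w ∈ s then faceSign k w (s.erase w) * c (s.erase w) else 0

/-- The cone is a contracting homotopy of the augmented full simplex. It need not preserve `Δ`, so
membership of cones in `Δ` is checked at each use. -/
theorem scalarBoundary_cone (w : V) (c : Finset V → k) :
    scalarBoundary (cone w c) = c - cone w (scalarBoundary c) := by
  funext s
  rw [Pi.sub_apply]
  by_cases hw : w ∈ s
  · obtain ⟨r, hr, rfl⟩ : ∃ r, w ∉ r ∧ s = insert w r :=
      ⟨s.erase w, Finset.notMem_erase w s, (Finset.insert_erase hw).symm⟩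
    rw [cone, if_pos hw, Finset.erase_insert hr, scalarBoundary, scalarBoundary,
      Finset.compl_insert, ← Finset.sum_erase_add rᶜ _ (Finset.mem_compl.2 hr), mul_add,
      ← mul_assoc (faceSign k w r) (faceSign k w r), faceSign_mul_self, one_mul,
      sub_add_cancel_right, Finset.mul_sum, ← Finset.sum_neg_distrib]
    refine Finset.sum_congr rfl fun v hv => ?_
    have hvw := Finset.ne_of_mem_erase hv
    have hvr := Finset.mem_compl.1 (Finset.mem_of_mem_erase hv)
    rw [cone, if_pos (by simp), Finset.insert_comm v w, Finset.erase_insert (by simp [hr, hvw.symm]),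
      ← mul_assoc, ← mul_assoc, ← neg_mul, faceSign_insert hr, faceSign_insert hvr]
    rcases hvw.lt_or_gt with h | h
    · simp [h, h.asymm, mul_comm (faceSign k w r)]
    · simp [h, h.asymm, mul_comm (faceSign k w r)]
  · rw [cone, if_neg hw, sub_zero, scalarBoundary,
      ← Finset.sum_erase_add sᶜ _ (Finset.mem_compl.2 hw), Finset.sum_eq_zero, zero_add, cone,
      if_pos (Finset.mem_insert_self w s), Finset.erase_insert hw, ← mul_assoc, faceSign_mul_self,
      one_mul]
    intro v hv
    rw [cone, if_neg (by simp [hw, (Finset.ne_of_mem_erase hv).symm]), mul_zero]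

variable {Δ : PreAbstractSimplicialComplex V} {W : Set V}

theorem ChainIn.scalarBoundary {c : Finset V → k} (hc : ChainIn Δ W c) :
    ChainIn Δ W (scalarBoundary c) := by
  intro s hs
  obtain ⟨v, -, hv⟩ := Finset.exists_ne_zero_of_sum_ne_zero hs
  rcases hc _ (right_ne_zero_of_mul hv) with h | h
  · exact absurd h (Finset.insert_ne_empty v s)
  · rcases s.eq_empty_or_nonempty with rfl | hne
    · exact Or.inl rfl
    · exact Or.inr ⟨mem_of_subset h.1 (Finset.subset_insert v s) hne,
        (Finset.coe_subset.2 (Finset.subset_insert v s)).trans h.2⟩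

theorem HasFreeVertices.exists_scalarBoundary_eq (hΔ : HasFreeVertices Δ) (W : Finset V)
    (hW : Linked Δ W) (hne : ∃ v ∈ W, {v} ∈ Δ) {c : Finset V → k} (hc : ChainIn Δ W c)
    (hcycle : scalarBoundary c = 0) : ∃ d, ChainIn Δ W d ∧ scalarBoundary d = c := by
  induction hn : W.card generalizing W c with
  | zero =>
    obtain ⟨v, hv, -⟩ := hne
    rw [Finset.card_eq_zero.1 hn] at hv
    simp at hv
  | succ n ih =>
    obtain ⟨v, hvW, hv, hfree⟩ := hΔ W hne
    -- If `v` is the only vertex, the cone from `v` fills the cycle, which can only live on `∅` and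
    -- `{v}`.
    by_cases hall : ∀ x ∈ W, {x} ∈ Δ → x = v
    · refine ⟨cone v c, fun s hs => Or.inr ?_, ?_⟩
      · unfold cone at hs
        split_ifs at hs with hvs
        · have : s = {v} := by
            rw [← Finset.insert_erase hvs]
            rcases hc _ (right_ne_zero_of_mul hs) with h | h
            · rw [h]; rfl
            · obtain ⟨x, hx⟩ := nonempty_of_mem h.1
              exact absurd (hall x (h.2 hx) (singleton_mem_of_mem h.1 hx))
                (Finset.ne_of_mem_erase hx)
          rw [this]
          exact ⟨hv, by simpa using hvW⟩
        · exact absurd rfl hs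
      · rw [scalarBoundary_cone, hcycle]
        funext s
        simp [cone]
    · push Not at hall
      obtain ⟨x, hxW, hx, hxv⟩ := hall
      obtain ⟨w, hwW, hvw, hwv⟩ : ∃ w ∈ W, {v, w} ∈ Δ ∧ w ≠ v := by
        by_contra! hcon
        exact hxv (hW (· = v) (by
          rintro _ - y hy hxy rfl
          exact hcon y hy hxy) v hvW x hxW hv hx rfl)
      have hvwW : (({v, w} : Finset V) : Set V) ⊆ W := by
        simp [Set.insert_subset_iff, hvW, hwW]
      -- The part of `c` on faces through `v`. Freeness of `v` allows `w` to be added to each of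
      -- these faces.
      set cv : Finset V → k := fun s => if v ∈ s then c s else 0 with hcv
      have hd : ChainIn Δ W (cone w cv) := by
        intro s hs
        right
        unfold cone at hs
        split_ifs at hs with hws
        · have hs' := right_ne_zero_of_mul hs
          simp only [hcv] at hs'
          split_ifs at hs' with hvs
          · rcases hc _ hs' with h | h
            · rw [h] at hvs
              simp at hvs
            · have hs_eq : s = s.erase w ∪ {v, w} := by
                rw [Finset.union_comm, Finset.insert_union, Finset.singleton_union,
                  Finset.insert_erase hws,
                  Finset.insert_eq_of_mem (Finset.mem_of_mem_erase hvs)]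
              rw [hs_eq, Finset.coe_union]
              exact ⟨hfree _ h.1 _ hvw h.2 hvwW hvs (by simp), Set.union_subset h.2 hvwW⟩
          · exact absurd rfl hs'
        · exact absurd rfl hs
      -- On faces through `v`, `cv` agrees with `c`, and so do their boundaries; the latter vanish,
      -- so the homotopy formula cancels `c` there.
      have hc1 : ChainIn Δ (W.erase v : Finset V) (c - scalarBoundary (cone w cv)) := by
        intro s hs
        refine ((hc.sub hd.scalarBoundary) s hs).imp_right fun h => ⟨h.1, ?_⟩
        intro x hx
        refine Finset.mem_coe.2 (Finset.mem_erase.2 ⟨?_, h.2 hx⟩)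
        rintro rfl
        apply hs
        have hxs : x ∈ s := hx
        have hcone : cone w (scalarBoundary cv) s = 0 := by
          unfold cone
          split_ifs with hws
          · have : scalarBoundary cv (s.erase w) = scalarBoundary c (s.erase w) := by
              refine Finset.sum_congr rfl fun u _ => ?_
              have : x ∈ insert u (s.erase w) := by simp [hwv.symm, hxs]
              simp only [hcv, if_pos this]
            rw [this, hcycle, Pi.zero_apply, mul_zero]
          · rfl
        rw [scalarBoundary_cone, Pi.sub_apply, Pi.sub_apply, hcone, sub_zero]
        simp [hcv, hxs]
      obtain ⟨d, hdW, hd_eq⟩ := ih (W.erase v)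
        (by
          rw [Finset.coe_erase]
          refine hW.diff_singleton hwW hwv fun y hy hvy => hfree _ hvy _ hvw ?_ hvwW (by simp)
            (by simp)
          simp only [Finset.coe_insert, Finset.coe_singleton, Set.insert_subset_iff,
            Set.singleton_subset_iff]
          exact ⟨hvW, hy⟩)
        ⟨w, Finset.mem_erase.2 ⟨hwv, hwW⟩, singleton_mem_of_mem hvw (by simp)⟩ hc1
        (by rw [scalarBoundary_sub, hcycle, scalarBoundary_scalarBoundary, sub_zero])
        (by rw [Finset.card_erase_of_mem hvW, hn, Nat.add_sub_cancel])
      refine ⟨cone w cv + d, hd.add (hdW.mono (Finset.coe_subset.2 (Finset.erase_subset v W))), ?_⟩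
      rw [scalarBoundary_add, hd_eq, add_sub_cancel]

end Chains

end QuasiTree
namespace QuasiTree

/-! ### Multigraded strands -/

section Components

open MvPolynomial

variable {V σ k : Type*} [Field k] {Δ : PreAbstractSimplicialComplex V}
  {m : V → σ →₀ ℕ} {t : ℕ}

theorem faceLabel_le_iff {s : Finset V} {M : σ →₀ ℕ} :
    faceLabel m s ≤ M ↔ (s : Set V) ⊆ {v | m v ≤ M} :=
  Finset.sup_le_iff

theorem faceLabel_mono {s s' : Finset V} (h : s ⊆ s') : faceLabel m s ≤ faceLabel m s' :=
  Finset.sup_mono h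

theorem faceLabel_singleton (v : V) : faceLabel m {v} = m v :=
  Finset.sup_singleton

open Classical in
/-- The component of multidegree `M` of a chain, as a scalar chain: the coefficient of the face `s`
is that of `X ^ (M - M_s) e_s`. -/
noncomputable def component (m : V → σ →₀ ℕ) (M : σ →₀ ℕ) (z : ChainModule k σ Δ t)
    (s : Finset V) : k :=
  if h : (s ∈ Δ ∧ s.card = t + 1) ∧ faceLabel m s ≤ M then
    coeff (M - faceLabel m s) (z ⟨s, h.1⟩)
  else 0

theorem component_of_face (M : σ →₀ ℕ) (z : ChainModule k σ Δ t) (s : FaceOfDim Δ t)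
    (h : faceLabel m s.1 ≤ M) : component m M z s.1 = coeff (M - faceLabel m s.1) (z s) :=
  dif_pos ⟨s.2, h⟩

theorem component_eq_zero {M : σ →₀ ℕ} {z : ChainModule k σ Δ t} {s : Finset V}
    (h : ¬((s ∈ Δ ∧ s.card = t + 1) ∧ faceLabel m s ≤ M)) : component m M z s = 0 :=
  dif_neg h

theorem of_component_ne_zero {M : σ →₀ ℕ} {z : ChainModule k σ Δ t} {s : Finset V}
    (h : component m M z s ≠ 0) : (s ∈ Δ ∧ s.card = t + 1) ∧ faceLabel m s ≤ M := by
  by_contra h'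
  exact h (component_eq_zero h')

theorem component_zero (M : σ →₀ ℕ) : component m M (0 : ChainModule k σ Δ t) = 0 := by
  funext s
  simp [component]

theorem component_add (M : σ →₀ ℕ) (z z' : ChainModule k σ Δ t) :
    component m M (z + z') = component m M z + component m M z' := by
  funext s
  simp only [component, Pi.add_apply]
  split_ifs <;> simp

theorem chainIn_component (M : σ →₀ ℕ) (z : ChainModule k σ Δ t) :
    ChainIn Δ {v | m v ≤ M} (component m M z) := fun _ hs =>
  Or.inr ⟨(of_component_ne_zero hs).1.1, faceLabel_le_iff.1 (of_component_ne_zero hs).2⟩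

theorem eq_of_component_eq {z z' : ChainModule k σ Δ t}
    (h : ∀ M, component m M z = component m M z') : z = z' := by
  refine Finsupp.ext fun s => MvPolynomial.ext _ _ fun a => ?_
  have := congrFun (h (a + faceLabel m s.1)) s.1
  rwa [component_of_face _ _ _ le_add_self, component_of_face _ _ _ le_add_self,
    add_tsub_cancel_right] at this

theorem finite_component_ne_zero (z : ChainModule k σ Δ t) :
    {M | component m M z ≠ 0}.Finite := by
  classical
  refine (z.support.biUnion fun s =>
    (z s).support.image (· + faceLabel m s.1)).finite_toSet.subset fun M hM => ?_
  obtain ⟨s, hs⟩ := Function.ne_iff.1 hM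
  obtain ⟨hface, hle⟩ := of_component_ne_zero hs
  rw [component_of_face M z ⟨s, hface⟩ hle] at hs
  simp only [Finset.coe_biUnion, Set.mem_iUnion, Finset.mem_coe, Finset.mem_image]
  refine ⟨⟨s, hface⟩, ?_, M - faceLabel m s, mem_support_iff.2 hs, tsub_add_cancel_of_le hle⟩
  rw [Finsupp.mem_support_iff]
  intro h0
  rw [h0, coeff_zero] at hs
  exact hs rfl

/-- Finiteness of the set of nonzero strands is what makes the glued coefficients polynomials. -/
theorem exists_component_eq [Finite V] {D : (σ →₀ ℕ) → Finset V → k} (hfin : {M | D M ≠ 0}.Finite)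
    (hD : ∀ M s, D M s ≠ 0 → (s ∈ Δ ∧ s.card = t + 1) ∧ faceLabel m s ≤ M) :
    ∃ z : ChainModule k σ Δ t, ∀ M, component m M z = D M := by
  classical
  refine ⟨Finsupp.equivFunOnFinite.symm fun s =>
    ∑ M ∈ hfin.toFinset with faceLabel m s.1 ≤ M, monomial (M - faceLabel m s.1) (D M s.1),
    fun M => funext fun s => ?_⟩
  by_cases h : (s ∈ Δ ∧ s.card = t + 1) ∧ faceLabel m s ≤ M
  · rw [component_of_face M _ ⟨s, h.1⟩ h.2, Finsupp.equivFunOnFinite_symm_apply_apply, coeff_sum]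
    by_cases hM : D M = 0
    · rw [hM]
      refine Finset.sum_eq_zero fun N hN => ?_
      rw [Finset.mem_filter, Set.Finite.mem_toFinset] at hN
      rw [coeff_monomial, if_neg]
      intro heq
      rw [tsub_left_inj hN.2 h.2] at heq
      exact hN.1 (heq ▸ hM)
    · rw [Finset.sum_eq_single M, coeff_monomial, if_pos rfl]
      · intro N hN hNM
        rw [Finset.mem_filter] at hN
        rw [coeff_monomial, if_neg]
        rwa [tsub_left_inj hN.2 h.2]
      · intro hN
        exact absurd (Finset.mem_filter.2 ⟨hfin.mem_toFinset.2 hM, h.2⟩) hN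
  · rw [component_eq_zero h]
    by_contra h'
    exact h (hD M s (Ne.symm h'))

theorem range_augmentation (k : Type*) [Field k] (Δ : PreAbstractSimplicialComplex V)
    (m : V → σ →₀ ℕ) :
    LinearMap.range (augmentation k Δ m) =
      Ideal.span ((fun v => monomial (m v) (1 : k)) '' vertices Δ) := by
  rw [augmentation, Finsupp.range_linearCombination, Ideal.span]
  congr 1
  ext p
  constructor
  · rintro ⟨⟨s, hs, hcard⟩, rfl⟩
    obtain ⟨v, rfl⟩ := Finset.card_eq_one.1 hcard
    exact ⟨v, hs, by simp only [faceLabel_singleton]⟩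
  · rintro ⟨v, hv, rfl⟩
    exact ⟨⟨{v}, hv, rfl⟩, by simp only [faceLabel_singleton]⟩

variable [LinearOrder V] [Fintype V]

open Classical in
-- Summing over the cofaces of `r` instead of the facets of `s` brings the differential into the
-- shape of `scalarBoundary`.
theorem boundary_apply (z : ChainModule k σ Δ (t + 1)) (r : FaceOfDim Δ t) :
    boundary k Δ m t z r = ∑ v ∈ r.1ᶜ,
      if h : insert v r.1 ∈ Δ ∧ (insert v r.1).card = t + 1 + 1 then
        monomial (faceLabel m (insert v r.1) - faceLabel m r.1) (faceSign k v r.1) *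
          z ⟨insert v r.1, h⟩
      else 0 := by
  induction z using Finsupp.induction_linear with
  | zero => simp
  | add z z' hz hz' =>
    rw [map_add, Finsupp.add_apply, hz, hz', ← Finset.sum_add_distrib]
    refine Finset.sum_congr rfl fun v _ => ?_
    split_ifs
    · rw [Finsupp.add_apply, mul_add]
    · rw [add_zero]
  | single s p =>
    rw [boundary, Finsupp.linearCombination_single, Finsupp.smul_apply, Finsupp.finsetSum_apply]
    by_cases hex : ∃ v, v ∉ r.1 ∧ insert v r.1 = s.1
    · obtain ⟨v, hv, hs⟩ := hex
      have hvs : v ∈ s.1 := hs ▸ Finset.mem_insert_self v r.1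
      have her : s.1.erase v = r.1 := by rw [← hs, Finset.erase_insert hv]
      rw [Finset.sum_eq_single ⟨v, hvs⟩, Finset.sum_eq_single v]
      · rw [dif_pos (by rw [hs]; exact s.2), Finsupp.single_apply, if_pos (Subtype.ext her),
          Finsupp.single_apply, if_pos (Subtype.ext hs.symm), her, hs, smul_eq_mul, mul_comm]
        congr 1
        have : s.1.filter (· < v) = r.1.filter (· < v) := by
          rw [← hs, Finset.filter_insert, if_neg (lt_irrefl v)]
        rw [this, ← mul_one (faceSign k v r.1), ← C_mul_monomial, faceSign, C_pow, C_neg, C_1]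
      · intro u _ huv
        split_ifs with h
        · rw [Finsupp.single_apply, if_neg, mul_zero]
          intro h'
          have h2 : s.1 = insert u r.1 := congrArg Subtype.val h'
          have : v ∈ insert u r.1 := h2 ▸ hvs
          rcases Finset.mem_insert.1 this with h3 | h3
          · exact huv h3.symm
          · exact hv h3
        · rfl
      · intro h
        exact absurd (Finset.mem_compl.2 hv) h
      · intro u _ huv
        rw [Finsupp.single_apply, if_neg]
        intro h'
        have h2 : s.1.erase u.1 = r.1 := congrArg Subtype.val h'
        apply huv
        apply Subtype.ext
        by_contra h3
        exact hv (h2 ▸ Finset.mem_erase.2 ⟨fun h => h3 h.symm, hvs⟩)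
      · intro h
        exact absurd (Finset.mem_attach _ _) h
    · rw [Finset.sum_eq_zero, Finset.sum_eq_zero, smul_zero]
      · intro v hv
        split_ifs with h
        · rw [Finsupp.single_apply, if_neg, mul_zero]
          intro h'
          exact hex ⟨v, Finset.mem_compl.1 hv, (congrArg Subtype.val h').symm⟩
        · rfl
      · intro u _
        rw [Finsupp.single_apply, if_neg]
        intro h'
        have h2 : s.1.erase u.1 = r.1 := congrArg Subtype.val h'
        exact hex ⟨u.1, h2 ▸ Finset.notMem_erase u.1 s.1, h2 ▸ Finset.insert_erase u.2⟩

/-- The coefficient `M_s / M_r` makes up exactly for the shift between the multidegrees of `e_s` and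
`e_r`. -/
theorem component_boundary (M : σ →₀ ℕ) (z : ChainModule k σ Δ (t + 1)) :
    component m M (boundary k Δ m t z) = scalarBoundary (component m M z) := by
  classical
  funext r
  by_cases h : (r ∈ Δ ∧ r.card = t + 1) ∧ faceLabel m r ≤ M
  · rw [component_of_face M _ ⟨r, h.1⟩ h.2, boundary_apply, coeff_sum, scalarBoundary]
    refine Finset.sum_congr rfl fun v _ => ?_
    by_cases h1 : insert v r ∈ Δ ∧ (insert v r).card = t + 1 + 1
    · have hle : faceLabel m r ≤ faceLabel m (insert v r) :=
        faceLabel_mono (Finset.subset_insert v r)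
      rw [dif_pos h1, coeff_monomial_mul']
      by_cases h2 : faceLabel m (insert v r) ≤ M
      · rw [if_pos (tsub_le_tsub_right h2 _), component_of_face M z ⟨_, h1⟩ h2,
          tsub_tsub_tsub_cancel_right hle]
      · rw [if_neg, component_eq_zero fun h' => h2 h'.2, mul_zero]
        rwa [tsub_le_tsub_iff_right h.2]
    · rw [dif_neg h1, coeff_zero, component_eq_zero fun h' => h1 h'.1, mul_zero]
  · rw [component_eq_zero h, scalarBoundary, Finset.sum_eq_zero]
    intro v hv
    by_contra hne
    obtain ⟨⟨hΔ, hcard⟩, hle⟩ := of_component_ne_zero (right_ne_zero_of_mul hne)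
    rw [Finset.card_insert_of_notMem (Finset.mem_compl.1 hv)] at hcard
    exact h ⟨⟨mem_of_subset hΔ (Finset.subset_insert v r) (Finset.card_pos.1 (by omega)),
      by omega⟩, (faceLabel_mono (Finset.subset_insert v r)).trans hle⟩

/-- The empty face plays the role of homological degree -1. -/
theorem coeff_augmentation (M : σ →₀ ℕ) (z : ChainModule k σ Δ 0) :
    coeff M (augmentation k Δ m z) = scalarBoundary (component m M z) ∅ := by
  classical
  induction z using Finsupp.induction_linear with
  | zero => rw [map_zero, component_zero, scalarBoundary_zero, coeff_zero, Pi.zero_apply]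
  | add z z' hz hz' =>
    rw [map_add, component_add, scalarBoundary_add, coeff_add, hz, hz', Pi.add_apply]
  | single s p =>
    obtain ⟨s, hs, hcard⟩ := s
    obtain ⟨v, rfl⟩ := Finset.card_eq_one.1 hcard
    rw [augmentation, Finsupp.linearCombination_single, smul_eq_mul, coeff_mul_monomial', mul_one,
      scalarBoundary, Finset.sum_eq_single v]
    · simp only [insert_empty_eq]
      split_ifs with h
      · rw [component_of_face M _ ⟨{v}, hs, hcard⟩ h, Finsupp.single_eq_same]
        simp [faceSign]
      · rw [component_eq_zero fun h' => h h'.2, mul_zero]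
    · intro u _ huv
      rw [component]
      split_ifs with h
      · rw [Finsupp.single_apply, if_neg, coeff_zero, mul_zero]
        intro h'
        exact huv (Finset.singleton_injective (congrArg Subtype.val h')).symm
      · rw [mul_zero]
    · intro h
      simp at h

/-! ### Exactness strand by strand -/

theorem augmentation_eq_zero_iff (z : ChainModule k σ Δ 0) :
    augmentation k Δ m z = 0 ↔ ∀ M, scalarBoundary (component m M z) = 0 := by
  constructor
  · intro h M
    funext s
    rcases s.eq_empty_or_nonempty with rfl | hs
    · rw [← coeff_augmentation, h, coeff_zero, Pi.zero_apply]
    · refine Finset.sum_eq_zero fun v hv => ?_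
      by_contra hne
      have hcard := (of_component_ne_zero (right_ne_zero_of_mul hne)).1.2
      rw [Finset.card_insert_of_notMem (Finset.mem_compl.1 hv)] at hcard
      have := hs.card_pos
      omega
  · intro h
    refine MvPolynomial.ext _ _ fun M => ?_
    rw [coeff_augmentation, h, coeff_zero, Pi.zero_apply]

theorem boundary_eq_zero_iff (z : ChainModule k σ Δ (t + 1)) :
    boundary k Δ m t z = 0 ↔ ∀ M, scalarBoundary (component m M z) = 0 := by
  constructor
  · intro h M
    rw [← component_boundary, h, component_zero]
  · intro h
    refine eq_of_component_eq (m := m) fun M => ?_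
    rw [component_boundary, h, component_zero]

/-- A graded cycle supported on a connected induced subcomplex is a graded boundary. -/
theorem exists_graded_scalarBoundary_eq (hΔ : HasFreeVertices Δ) {M : σ →₀ ℕ}
    (hlink : Linked Δ {v | m v ≤ M}) (z : ChainModule k σ Δ t)
    (hcycle : scalarBoundary (component m M z) = 0) :
    ∃ d : Finset V → k, (component m M z = 0 → d = 0) ∧
      (∀ s, d s ≠ 0 → (s ∈ Δ ∧ s.card = t + 1 + 1) ∧ faceLabel m s ≤ M) ∧
      scalarBoundary d = component m M z := by
  classical
  by_cases h0 : component m M z = 0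
  -- Zero strands get zero fillings, so only finitely many fillings are nonzero; this also covers
  -- empty `Δ_M`.
  · exact ⟨0, fun _ => rfl, fun s hs => absurd rfl hs, by rw [scalarBoundary_zero, h0]⟩
  obtain ⟨s, hs⟩ := Function.ne_iff.1 h0
  obtain ⟨hface, hle⟩ := of_component_ne_zero hs
  obtain ⟨v, hv⟩ := nonempty_of_mem hface.1
  have hcoe : ((Finset.univ.filter fun v => m v ≤ M : Finset V) : Set V) = {v | m v ≤ M} := by
    simp
  obtain ⟨d, hd, hdz⟩ := hΔ.exists_scalarBoundary_eq (Finset.univ.filter fun v => m v ≤ M)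
    (hcoe.symm ▸ hlink)
    ⟨v, by simpa using faceLabel_le_iff.1 hle hv, singleton_mem_of_mem hface.1 hv⟩
    (c := component m M z) (hcoe.symm ▸ chainIn_component M z) hcycle
  rw [hcoe] at hd
  -- A filling may have parts in other degrees. Since the boundary lowers cardinality by one, the
  -- part on faces with `t + 2` vertices already suffices.
  refine ⟨fun s => if s.card = t + 1 + 1 then d s else 0, fun h => absurd h h0,
    fun s hs => ?_, funext fun s => ?_⟩
  · simp only [ne_eq, ite_eq_right_iff, Classical.not_imp] at hs
    rcases hd s hs.2 with rfl | h
    · simp at hs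
    · exact ⟨⟨h.1, hs.1⟩, faceLabel_le_iff.2 h.2⟩
  · have hcard : ∀ v ∈ sᶜ, (insert v s).card = s.card + 1 := fun v hv =>
      Finset.card_insert_of_notMem (Finset.mem_compl.1 hv)
    by_cases hs : s.card = t + 1
    · rw [← hdz]
      refine Finset.sum_congr rfl fun v hv => ?_
      simp only [hcard v hv, hs, if_true]
    · rw [component_eq_zero fun h => hs h.1.2]
      refine Finset.sum_eq_zero fun v hv => ?_
      simp only [hcard v hv, Nat.add_right_cancel_iff, if_neg hs, mul_zero]

theorem mem_range_boundary_iff (hΔ : HasFreeVertices Δ) (hlink : ∀ M, Linked Δ {v | m v ≤ M})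
    (z : ChainModule k σ Δ t) :
    z ∈ Set.range (boundary k Δ m t) ↔ ∀ M, scalarBoundary (component m M z) = 0 := by
  constructor
  · rintro ⟨y, rfl⟩ M
    rw [component_boundary, scalarBoundary_scalarBoundary]
  · intro h
    choose D h0 hD hbd using fun M => exists_graded_scalarBoundary_eq hΔ (hlink M) z (h M)
    obtain ⟨y, hy⟩ := exists_component_eq
      ((finite_component_ne_zero z).subset fun M hM hzero => hM (h0 M hzero)) hD
    refine ⟨y, eq_of_component_eq (m := m) fun M => ?_⟩
    rw [component_boundary, hy, hbd]

theorem linked_of_exact (h : Function.Exact (boundary k Δ m 0) (augmentation k Δ m))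
    (M : σ →₀ ℕ) : Linked Δ {v | m v ≤ M} := by
  classical
  intro P hP a haM b hbM ha hb hPa
  by_contra hPb
  have hab : a ≠ b := by
    rintro rfl
    exact hPb hPa
  let fa : FaceOfDim Δ 0 := ⟨{a}, ha, rfl⟩
  let fb : FaceOfDim Δ 0 := ⟨{b}, hb, rfl⟩
  have hfab : fb ≠ fa := fun h => hab (Finset.singleton_injective (congrArg Subtype.val h)).symm
  -- Both terms are sent to the monomial `M`.
  obtain ⟨y, hy⟩ := (h (Finsupp.single fa (monomial (M - m a) 1) -
      Finsupp.single fb (monomial (M - m b) 1))).1 (by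
    rw [map_sub, augmentation, Finsupp.linearCombination_single, Finsupp.linearCombination_single,
      faceLabel_singleton, faceLabel_singleton, smul_eq_mul, smul_eq_mul, monomial_mul,
      monomial_mul, tsub_add_cancel_of_le haM, tsub_add_cancel_of_le hbM, sub_self])
  set z := Finsupp.single fa (monomial (M - m a) (1 : k)) -
      Finsupp.single fb (monomial (M - m b) 1) with hz
  have hbd : scalarBoundary (component m M y) = component m M z := by
    rw [← component_boundary, hy]
  -- Summing coefficients over the vertices with `P` counts `a` but not `b`.
  have hone : ∑ w with P w, component m M z {w} = 1 := by
    rw [Finset.sum_eq_single a]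
    · rw [component_of_face M z fa (by rw [faceLabel_singleton]; exact haM), hz,
        Finsupp.sub_apply, Finsupp.single_eq_same, Finsupp.single_apply, if_neg hfab, sub_zero,
        faceLabel_singleton, coeff_monomial, if_pos rfl]
    · intro w hw hwa
      have hwb : w ≠ b := by
        rintro rfl
        exact hPb (Finset.mem_filter.1 hw).2
      rw [component]
      split_ifs with hface
      · rw [hz, Finsupp.sub_apply, Finsupp.single_apply, Finsupp.single_apply, if_neg, if_neg,
          sub_zero, coeff_zero]
        · exact fun h => hwb (Finset.singleton_injective (congrArg Subtype.val h)).symm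
        · exact fun h => hwa (Finset.singleton_injective (congrArg Subtype.val h)).symm
      · rfl
    · intro h
      exact absurd (Finset.mem_filter.2 ⟨Finset.mem_univ a, hPa⟩) h
  have hzero : ∑ w with P w, component m M z {w} = 0 := by
    rw [← hbd]
    -- No edge of `Δ_M` leaves the set where `P` holds, so only edges with both ends in it
    -- contribute, and each of these does so twice with opposite signs.
    have : ∀ w ∈ Finset.univ.filter P, scalarBoundary (component m M y) {w} =
        ∑ u ∈ Finset.univ.filter P,
          if w = u then 0 else faceSign k u {w} * component m M y {u, w} := by
      intro w hw
      refine (Finset.sum_congr rfl fun u hu => ?_).trans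
        (Finset.sum_subset (Finset.subset_univ {w}ᶜ) fun u _ hu => ?_) |>.trans
        (Finset.sum_subset (Finset.subset_univ (Finset.univ.filter P)) fun u _ hu => ?_).symm
      · have huw : u ≠ w := by simpa using hu
        rw [if_neg huw.symm]
      · have huw : u = w := by simpa using hu
        rw [if_pos huw.symm]
      · split_ifs with huw
        · rfl
        · rw [component_eq_zero, mul_zero]
          rintro ⟨⟨hface, -⟩, hle⟩
          have hmem := faceLabel_le_iff.1 hle
          exact hu (Finset.mem_filter.2 ⟨Finset.mem_univ u, hP w (hmem (by simp)) u
            (hmem (by simp)) (Finset.pair_comm u w ▸ hface) (Finset.mem_filter.1 hw).2⟩)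
    rw [Finset.sum_congr rfl this]
    refine sum_sum_eq_zero_of_antisymm (fun _ => if_pos rfl) fun u _ w _ => ?_
    by_cases huw : u = w
    · simp [huw]
    · have hsign := faceSign_mul_faceSign_insert (k := k) (Finset.notMem_empty u)
        (Finset.notMem_empty w) huw
      simp only [faceSign, Finset.filter_empty, Finset.card_empty, pow_zero, one_mul,
        insert_empty_eq] at hsign
      rw [if_neg huw, if_neg (Ne.symm huw), Finset.pair_comm w u, ← neg_mul]
      simp only [faceSign, hsign]
  exact one_ne_zero (hone.symm.trans hzero)

end Components

end QuasiTree

theorem theorem3p5 {k σ V : Type*} [Field k] [Finite V] [LinearOrder V]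
    (Δ : PreAbstractSimplicialComplex V) (hΔ : QuasiTree.IsQuasiTree Δ)
    (m : V → σ →₀ ℕ) (I : Ideal (MvPolynomial σ k))
    (hI : I = Ideal.span
      ((fun v => MvPolynomial.monomial (m v) (1 : k)) '' QuasiTree.vertices Δ)) :
    QuasiTree.SupportsFreeResolution Δ m I ↔
      ∀ M : σ →₀ ℕ, QuasiTree.restrictTo Δ m M = ⊥ ∨
        QuasiTree.IsConnected (QuasiTree.restrictTo Δ m M) := by
  have := Fintype.ofFinite V
  unfold QuasiTree.restrictTo
  simp only [← QuasiTree.linked_iff_induced_eq_bot_or_isConnected]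
  refine ⟨fun h => QuasiTree.linked_of_exact h.2.1, fun h => ⟨?_, fun z => ?_, fun t z => ?_⟩⟩
  · rw [hI, QuasiTree.range_augmentation]
  · rw [QuasiTree.mem_range_boundary_iff hΔ.2.hasFreeVertices h,
      QuasiTree.augmentation_eq_zero_iff]
  · rw [QuasiTree.mem_range_boundary_iff hΔ.2.hasFreeVertices h, QuasiTree.boundary_eq_zero_iff]
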